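/- Let $\mathcal A$ be an abelian category with enough projective objects, let $D^b(\mathcal A)$ be its bounded derived category, and let $K^b(\mathcal P)$ be the homotopy category of bounded complexes of projective objects of $\mathcal A$. The canonical functor $K^b(\mathcal P)\to D^b(\mathcal A)$ is fully faithful, and $K^b(\mathcal P)$ is identified with its essential image. An object $P$ of $D^b(\mathcal A)$ is called perfect if for each $Y\in D^b(\mathcal A)$ there are only finitely many $i\in\mathbb Z$ with $\operatorname{Hom}(P,Y[i])\neq 0$; write $D^b_{\rm perf}(\mathcal A)$ for the full subcategory of perfect objects. The category $\mathcal A$ is called finitely filtrated if there are finitely many objects $S_1,\dots,S_m$ such that for each $0\ne X\in\mathcal A$ there is a finite sequence of monomorphisms $0=X_0\xrightarrow{f_1}X_1\to\cdots\xrightarrow{f_n}X_n=X$ with each $\operatorname{Coker} f_i$ isomorphic to one of $S_1,\dots,S_m$. (1) If $\mathcal A$ is finitely filtrated, then $D^b_{\rm perf}(\mathcal A)=K^b(\mathcal P)$. (2) If $\mathcal A$ has infinite direct sums (it is enough that countable direct sums exist), then $D^b_{\rm perf}(\mathcal A)=K^b(\mathcal P)$. -/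

import Mathlib

open CategoryTheory CategoryTheory.Limits

universe w v u

/-- An object `P` of a (triangulated) category `D` with shift is perfect if, for each object `Y`,
there are only finitely many `i : ℤ` such that `Hom(P, Y[i]) ≠ 0`. -/
def IsPerfectObject (D : Type u) [Category.{v} D] [HasZeroMorphisms D] [HasShift D ℤ] :
    ObjectProperty D := fun P =>
  ∀ Y : D, {i : ℤ | ∃ f : P ⟶ Y⟦i⟧, f ≠ 0}.Finite

/-- There are finitely many objects `S 1, …, S m` such that each nonzero object `X` is the last
term of a finite sequence of monomorphisms which starts at a zero object and whose cokernels
belong, up to isomorphism, to `{S 1, …, S m}`. -/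
def IsFinitelyFiltrated (𝒜 : Type u) [Category.{v} 𝒜] [Abelian 𝒜] : Prop :=
  ∃ (m : ℕ) (S : Fin m → 𝒜), ∀ X : 𝒜, ¬ IsZero X →
    ∃ (n : ℕ) (F : Fin (n + 1) → 𝒜) (f : ∀ i : Fin n, F i.castSucc ⟶ F i.succ),
      IsZero (F 0) ∧ Nonempty (F (Fin.last n) ≅ X) ∧
      ∀ i : Fin n, Mono (f i) ∧ ∃ j : Fin m, Nonempty (cokernel (f i) ≅ S j)

section

variable (𝒜 : Type u) [Category.{v} 𝒜] [Abelian 𝒜]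

/-- The objects of the homotopy category of cochain complexes given by bounded complexes with
projective terms. -/
def boundedProjectiveComplex : ObjectProperty (HomotopyCategory 𝒜 (ComplexShape.up ℤ)) :=
  fun K => (∀ i : ℤ, Projective (K.as.X i)) ∧
    ∃ a b : ℤ, ∀ i : ℤ, (i < a ∨ b < i) → IsZero (K.as.X i)

/-- `K^b(𝒫)`: the homotopy category of bounded complexes of projective objects. -/
abbrev KbProjective : Type max u v := (boundedProjectiveComplex 𝒜).FullSubcategory

/-- The canonical functor `K^b(𝒫) ⥤ D^b(𝒜)`, the restriction of the localization functor
from the homotopy category to the derived category. -/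
noncomputable def KbProjective.toBounded [HasDerivedCategory.{w} 𝒜] :
    KbProjective 𝒜 ⥤ DerivedCategory.Bounded 𝒜 :=
  (DerivedCategory.TStructure.t (C := 𝒜)).bounded.lift
    ((boundedProjectiveComplex 𝒜).ι ⋙ DerivedCategory.Qh) (by
      rintro ⟨K, hK⟩
      obtain ⟨K : CochainComplex _ _, rfl⟩ := HomotopyCategory.quotient_obj_surjective K
      obtain ⟨-, a, b, h⟩ := hK
      have h' : ∀ i : ℤ, (i < a ∨ b < i) → IsZero (K.X i) := h
      have : K.IsStrictlyGE a :=
        (CochainComplex.isStrictlyGE_iff K a).2 (fun i hi => h' i (Or.inl hi))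
      have : K.IsStrictlyLE b :=
        (CochainComplex.isStrictlyLE_iff K b).2 (fun i hi => h' i (Or.inr hi))
      exact ⟨⟨a, DerivedCategory.TStructure.t.isGE_of_iso
          ((DerivedCategory.quotientCompQhIso 𝒜).symm.app K) a⟩,
        ⟨b, DerivedCategory.TStructure.t.isLE_of_iso
          ((DerivedCategory.quotientCompQhIso 𝒜).symm.app K) b⟩⟩)

end

open CategoryTheory.Pretriangulated

/-! Bounded complexes of projectives are K-projective, so their maps in the derived category come
from chain maps. This gives full faithfulness, closure of `boundedProjective` under cones, and
perfectness. Conversely, if Hom(P, A[-n]) vanishes for all A below one bound, killing the top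
cohomology by projectives reduces P to a single object, which the vanishing forces to be projective
(`boundedProjective_of_singleFunctor_eq_zero`). Perfectness gives a bound depending on A; uniformity
comes from the finitely many filtration factors, or from testing P against one countable coproduct.
-/

/-- A cochain complex is bounded projective if it is bounded with projective terms. -/
def CochainComplex.IsBoundedProjective {𝒜 : Type u} [Category.{v} 𝒜] [Abelian 𝒜]
    (K : CochainComplex 𝒜 ℤ) : Prop :=
  (∀ i : ℤ, Projective (K.X i)) ∧ ∃ a b : ℤ, ∀ i : ℤ, (i < a ∨ b < i) → IsZero (K.X i)

namespace CochainComplex.IsBoundedProjective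

variable {𝒜 : Type u} [Category.{v} 𝒜] [Abelian 𝒜]

lemma isKProjective {K : CochainComplex 𝒜 ℤ} (hK : K.IsBoundedProjective) :
    K.IsKProjective := by
  obtain ⟨hp, a, b, h⟩ := hK
  have : K.IsStrictlyLE b := (isStrictlyLE_iff K b).2 (fun i hi => h i (Or.inr hi))
  exact isKProjective_of_projective K b

lemma single (P : 𝒜) [Projective P] (n : ℤ) :
    IsBoundedProjective ((CochainComplex.singleFunctor 𝒜 n).obj P) := by
  refine ⟨fun i => ?_, n, n, fun i hi => ?_⟩
  · by_cases h : i = n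
    · subst h
      exact Projective.of_iso (HomologicalComplex.singleObjXSelf (.up ℤ) i P).symm inferInstance
    · exact (HomologicalComplex.isZero_single_obj_X (.up ℤ) n P i h).projective
  · exact HomologicalComplex.isZero_single_obj_X (.up ℤ) n P i (by lia)

lemma shift {K : CochainComplex 𝒜 ℤ} (hK : K.IsBoundedProjective) (n : ℤ) :
    IsBoundedProjective (K⟦n⟧) := by
  obtain ⟨hp, a, b, h⟩ := hK
  exact ⟨fun i => hp (i + n), a - n, b - n, fun i hi => h (i + n) (by lia)⟩

lemma mappingCone {K L : CochainComplex 𝒜 ℤ} (hK : K.IsBoundedProjective)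
    (hL : L.IsBoundedProjective) (φ : K ⟶ L) :
    IsBoundedProjective (CochainComplex.mappingCone φ) := by
  obtain ⟨hp, a, b, h⟩ := hK
  obtain ⟨hp', a', b', h'⟩ := hL
  refine ⟨fun i => ?_, min (a - 1) a', max b b', fun i hi => ?_⟩
  · have := hp (i + 1)
    have := hp' i
    exact Projective.of_iso
      (HomologicalComplex.homotopyCofiber.XIsoBiprod φ i (i + 1) rfl).symm inferInstance
  · refine IsZero.of_iso ?_ (HomologicalComplex.homotopyCofiber.XIsoBiprod φ i (i + 1) rfl)
    rw [biprod_isZero_iff]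
    exact ⟨h _ (by lia), h' _ (by lia)⟩

end CochainComplex.IsBoundedProjective

/-! ### Bounded projective objects and their detection by vanishing of Hom -/

namespace DerivedCategory

variable {𝒜 : Type u} [Category.{v} 𝒜] [Abelian 𝒜] [HasDerivedCategory.{w} 𝒜]

lemma Q_map_surjective_of_isKProjective (K L : CochainComplex 𝒜 ℤ) [K.IsKProjective]
    (f : Q.obj K ⟶ Q.obj L) : ∃ φ : K ⟶ L, Q.map φ = f := by
  obtain ⟨g, hg⟩ := (CochainComplex.IsKProjective.Qh_map_bijective K
    ((HomotopyCategory.quotient _ _).obj L)).surjective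
    ((quotientCompQhIso 𝒜).hom.app K ≫ f ≫ (quotientCompQhIso 𝒜).inv.app L)
  obtain ⟨φ, rfl⟩ := (HomotopyCategory.quotient _ _).map_surjective g
  refine ⟨φ, ?_⟩
  rw [← cancel_epi ((quotientCompQhIso 𝒜).hom.app K), ← quotientCompQhIso_hom_naturality, hg]
  simp

variable (𝒜) in
/-- The objects of the derived category which are isomorphic to the image of a bounded complex
of projective objects. -/
def boundedProjective : ObjectProperty (DerivedCategory 𝒜) := fun X =>
  ∃ K : CochainComplex 𝒜 ℤ, K.IsBoundedProjective ∧ Nonempty (X ≅ Q.obj K)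

instance : (boundedProjective 𝒜).IsClosedUnderIsomorphisms where
  of_iso e := by
    rintro ⟨K, hK, ⟨e'⟩⟩
    exact ⟨K, hK, ⟨e.symm ≪≫ e'⟩⟩

lemma boundedProjective_singleFunctor (P : 𝒜) [Projective P] (n : ℤ) :
    boundedProjective 𝒜 ((singleFunctor 𝒜 n).obj P) :=
  ⟨_, .single P n, ⟨(singleFunctorIsoCompQ 𝒜 n).app P⟩⟩

lemma boundedProjective_shift {X : DerivedCategory 𝒜} (hX : boundedProjective 𝒜 X) (n : ℤ) :
    boundedProjective 𝒜 (X⟦n⟧) := by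
  obtain ⟨K, hK, ⟨e⟩⟩ := hX
  exact ⟨_, hK.shift n, ⟨(shiftFunctor _ n).mapIso e ≪≫ (Q.commShiftIso n).symm.app K⟩⟩

lemma boundedProjective_obj₃ (T : Triangle (DerivedCategory 𝒜)) (hT : T ∈ distTriang _)
    (h₁ : boundedProjective 𝒜 T.obj₁) (h₂ : boundedProjective 𝒜 T.obj₂) :
    boundedProjective 𝒜 T.obj₃ := by
  obtain ⟨K, hK, ⟨e₁⟩⟩ := h₁
  obtain ⟨L, hL, ⟨e₂⟩⟩ := h₂
  have := hK.isKProjective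
  obtain ⟨φ, hφ⟩ := Q_map_surjective_of_isKProjective K L (e₁.inv ≫ T.mor₁ ≫ e₂.hom)
  have comm : T.mor₁ ≫ e₂.hom = e₁.hom ≫ Q.map φ := by simp [hφ]
  exact ⟨_, hK.mappingCone hL φ, ⟨Triangle.π₃.mapIso
    (isoTriangleOfIso₁₂ T _ hT (mappingCone_triangle_distinguished φ) e₁ e₂ comm)⟩⟩

lemma boundedProjective_obj₂ (T : Triangle (DerivedCategory 𝒜)) (hT : T ∈ distTriang _)
    (h₁ : boundedProjective 𝒜 T.obj₁) (h₃ : boundedProjective 𝒜 T.obj₃) :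
    boundedProjective 𝒜 T.obj₂ :=
  boundedProjective_obj₃ _ (inv_rot_of_distTriang _ hT) (boundedProjective_shift h₃ (-1)) h₁

/-- A bounded complex of projective objects has no nonzero morphism to objects
in sufficiently negative degrees. -/
lemma exists_eq_zero_of_boundedProjective {X : DerivedCategory 𝒜}
    (hX : boundedProjective 𝒜 X) :
    ∃ a : ℤ, ∀ (Y : DerivedCategory 𝒜) (n : ℤ) (_ : n < a) [Y.IsLE n] (f : X ⟶ Y), f = 0 := by
  obtain ⟨K, hK, ⟨e⟩⟩ := hX
  have := hK.isKProjective
  obtain ⟨-, a, b, h⟩ := hK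
  refine ⟨a, fun Y n hn _ f => ?_⟩
  obtain ⟨L, _, ⟨e'⟩⟩ := Y.exists_iso_Q_obj_of_isLE n
  obtain ⟨φ, hφ⟩ := Q_map_surjective_of_isKProjective K L (e.inv ≫ f ≫ e'.hom)
  have hφ₀ : φ = 0 := by
    ext i
    by_cases hi : i < a
    · exact (h i (Or.inl hi)).eq_of_src _ _
    · exact (L.isZero_of_isStrictlyLE n i (by lia)).eq_of_tgt _ _
  rw [hφ₀, Functor.map_zero] at hφ
  rw [← cancel_epi e.inv, ← cancel_mono e'.hom, Category.assoc, ← hφ]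
  simp

lemma singleFunctor_eq_zero_of_projective {P : 𝒜} [Projective P] {a : ℤ}
    {Y : DerivedCategory 𝒜} (n : ℤ) (hn : n < a) [Y.IsLE n]
    (f : (singleFunctor 𝒜 a).obj P ⟶ Y) : f = 0 := by
  obtain ⟨L, _, ⟨e'⟩⟩ := Y.exists_iso_Q_obj_of_isLE n
  rw [← cancel_mono e'.hom, zero_comp]
  exact from_singleFunctor_obj_eq_zero_of_projective (L := L) _ n hn

/-- The homology in degree `b` of `X` receives an epimorphism
from a projective object which is induced by a morphism in the derived category. -/
lemma exists_projective_epi_homologyMap [EnoughProjectives 𝒜] (X : DerivedCategory 𝒜) (b : ℤ) :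
    ∃ (P : 𝒜) (_ : Projective P) (f : (singleFunctor 𝒜 b).obj P ⟶ X),
      Epi ((homologyFunctor 𝒜 b).map f) := by
  let K := Q.objPreimage X
  let π := Projective.π (K.homology b)
  let l := Projective.factorThru π (K.homologyπ b)
  have hl : l ≫ K.homologyπ b = π := Projective.factorThru_comp _ _
  let φ : (HomologicalComplex.single 𝒜 (.up ℤ) b).obj (Projective.over (K.homology b)) ⟶ K :=
    HomologicalComplex.mkHomFromSingle (l ≫ K.iCycles b) (by simp)
  have hφ : HomologicalComplex.cyclesMap φ b =
      (HomologicalComplex.singleObjCyclesSelfIso (.up ℤ) b _).hom ≫ l := by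
    rw [← cancel_mono (K.iCycles b), HomologicalComplex.cyclesMap_i]
    simp [φ, HomologicalComplex.singleObjCyclesSelfIso_hom]
  have : Epi (HomologicalComplex.homologyMap φ b) := by
    have : Epi (HomologicalComplex.homologyπ _ b ≫ HomologicalComplex.homologyMap φ b) := by
      rw [HomologicalComplex.homologyπ_naturality, hφ, Category.assoc, hl]
      infer_instance
    exact epi_of_epi (HomologicalComplex.homologyπ _ b) _
  have : Epi ((homologyFunctor 𝒜 b).map (Q.map φ)) :=
    ((MorphismProperty.epimorphisms 𝒜).arrow_mk_iso_iff
      (((Functor.mapArrowFunctor _ _).mapIso (homologyFunctorFactors 𝒜 b)).app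
        (Arrow.mk φ))).2 this
  have : Epi ((homologyFunctor 𝒜 b).map (Q.map φ ≫ (Q.objObjPreimageIso X).hom)) := by
    rw [Functor.map_comp]
    infer_instance
  exact ⟨_, inferInstance, Q.map φ ≫ (Q.objObjPreimageIso X).hom, this⟩

/-- By the long exact sequence, surjectivity on `H^b` kills the top cohomology of the cone. The
kernel of that surjection lands in degree `b - 1`, hence the `min`. -/
lemma exists_projective_triangle [EnoughProjectives 𝒜] (X : DerivedCategory 𝒜) (a b : ℤ)
    [X.IsLE b] [X.IsGE a] :
    ∃ (P : 𝒜) (_ : Projective P) (C : DerivedCategory 𝒜) (f : (singleFunctor 𝒜 b).obj P ⟶ X)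
      (g : X ⟶ C) (h : C ⟶ ((singleFunctor 𝒜 b).obj P)⟦(1 : ℤ)⟧),
      Triangle.mk f g h ∈ distTriang _ ∧ C.IsLE (b - 1) ∧ C.IsGE (min a (b - 1)) := by
  obtain ⟨P, hP, f, hf⟩ := exists_projective_epi_homologyMap X b
  obtain ⟨C, g, h, hT⟩ := distinguished_cocone_triangle f
  have key (i : ℤ) (hi : i + 1 ≠ b) (hX : (homologyFunctor 𝒜 i).map g = 0) :
      IsZero ((homologyFunctor 𝒜 i).obj C) := by
    refine (HomologySequence.exact₃ _ hT i (i + 1)).isZero_of_both_zeros hX ?_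
    refine IsZero.eq_of_tgt ?_ _ _
    obtain hi | hi := lt_or_gt_of_ne hi
    · exact ((singleFunctor 𝒜 b).obj P).isZero_of_isGE b _ hi
    · exact ((singleFunctor 𝒜 b).obj P).isZero_of_isLE b _ hi
  refine ⟨P, hP, C, f, g, h, hT, (isLE_iff _ _).2 fun i hi => key i (by lia) ?_,
    (isGE_iff _ _).2 fun i hi => key i (by lia)
      ((X.isZero_of_isGE a i (by lia)).eq_of_src _ _)⟩
  obtain rfl | hi : i = b ∨ b < i := by lia
  · exact (HomologySequence.epi_homologyMap_mor₁_iff _ hT i).1 hf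
  · exact (X.isZero_of_isLE b i hi).eq_of_src _ _

/-- A bounded object with no nonzero morphisms to objects of the abelian category placed
in sufficiently negative degrees is a bounded complex of projective objects. -/
lemma boundedProjective_of_singleFunctor_eq_zero [EnoughProjectives 𝒜] (a : ℤ) (k : ℕ)
    (X : DerivedCategory 𝒜) [X.IsGE a] [hb : X.IsLE (a + k)]
    (hX : ∀ (A : 𝒜) (n : ℤ) (_ : n < a) (f : X ⟶ (singleFunctor 𝒜 n).obj A), f = 0) :
    boundedProjective 𝒜 X := by
  induction k generalizing X with
  | zero =>
    have : X.IsLE a := by simpa using hb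
    obtain ⟨P, _, C, f, g, h, hT, _, hC⟩ := X.exists_projective_triangle a a
    have : C.IsGE (a - 1) := by rwa [min_eq_right (by lia)] at hC
    obtain ⟨A, ⟨eA⟩⟩ := C.exists_iso_singleFunctor_obj_of_isGE_of_isLE (a - 1)
    obtain ⟨M, ⟨eM⟩⟩ := X.exists_iso_singleFunctor_obj_of_isGE_of_isLE a
    -- The cone sits in degree `a - 1`, where `hX` applies; so `f` splits and `X` is a retract of a
    -- projective.
    have hg : g = 0 := by
      rw [← cancel_mono eA.hom, hX A _ (by lia) (g ≫ eA.hom), zero_comp]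
    obtain ⟨s, hs⟩ : ∃ s : X ⟶ (singleFunctor 𝒜 a).obj P, 𝟙 X = s ≫ f :=
      Triangle.coyoneda_exact₂ _ hT (𝟙 X) (by
        change 𝟙 X ≫ g = 0
        rw [hg, comp_zero])
    have : Projective M := by
      let r : Retract M P :=
        { i := (singleFunctor 𝒜 a).preimage (eM.inv ≫ s)
          r := (singleFunctor 𝒜 a).preimage (f ≫ eM.hom)
          retract := (singleFunctor 𝒜 a).map_injective (by simp [← reassoc_of% hs]) }
      exact r.projective
    exact (boundedProjective 𝒜).prop_of_iso eM.symm (boundedProjective_singleFunctor M a)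
  | succ k ih =>
    obtain ⟨P, _, C, f, g, h, hT, hle, hge⟩ := X.exists_projective_triangle a (a + (k + 1 : ℕ))
    have : C.IsLE (a + k) := by
      convert! hle using 1
      lia
    have : C.IsGE a := by rwa [min_eq_left (by lia)] at hge
    refine boundedProjective_obj₂ _ hT (boundedProjective_singleFunctor P _)
      (ih C fun A n hn φ => ?_)
    -- `φ` dies on `X`, so it factors through the shifted projective, which sits in degree `a + k >
    -- n`.
    obtain ⟨ψ, hψ⟩ : ∃ ψ : ((singleFunctor 𝒜 (a + (k + 1 : ℕ))).obj P)⟦(1 : ℤ)⟧ ⟶ _,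
        φ = h ≫ ψ := Triangle.yoneda_exact₃ _ hT φ (hX A n hn _)
    have : ψ = 0 := by
      let e := ((singleFunctors 𝒜).shiftIso 1 (a + k) (a + (k + 1 : ℕ)) (by lia)).app P
      refine (cancel_epi e.inv).1 (Eq.trans ?_ comp_zero.symm)
      exact singleFunctor_eq_zero_of_projective n (by lia) _
    rw [hψ, this, comp_zero]

/-- For an object `X` and `n : ℤ`, the vanishing of `Hom(X, A[-n])` is stable by extensions. -/
lemma singleFunctor_eq_zero_of_shortExact {X : DerivedCategory 𝒜} {n : ℤ} {S : ShortComplex 𝒜}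
    (hS : S.ShortExact) (h₁ : ∀ f : X ⟶ (singleFunctor 𝒜 n).obj S.X₁, f = 0)
    (h₃ : ∀ f : X ⟶ (singleFunctor 𝒜 n).obj S.X₃, f = 0)
    (f : X ⟶ (singleFunctor 𝒜 n).obj S.X₂) : f = 0 := by
  obtain ⟨g, hg⟩ := Triangle.coyoneda_exact₂ _ (triangleOfSES_distinguished
    (hS.map_of_exact (HomologicalComplex.single 𝒜 (.up ℤ) n))) f (h₃ _)
  rw [hg, h₁ g]
  exact zero_comp

end DerivedCategory

/-! ### Full faithfulness and essential image -/

lemma boundedProjectiveComplex.exists_quotient_obj_eq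
    {𝒜 : Type u} [Category.{v} 𝒜] [Abelian 𝒜] {K : HomotopyCategory 𝒜 (ComplexShape.up ℤ)}
    (hK : boundedProjectiveComplex 𝒜 K) :
    ∃ L : CochainComplex 𝒜 ℤ, L.IsBoundedProjective ∧
      (HomotopyCategory.quotient _ _).obj L = K := by
  obtain ⟨L : CochainComplex _ _, rfl⟩ := HomotopyCategory.quotient_obj_surjective K
  exact ⟨L, hK, rfl⟩

variable (𝒜 : Type u) [Category.{v} 𝒜] [Abelian 𝒜] [HasDerivedCategory.{w} 𝒜]

lemma KbProjective.map_Qh_bijective (K L : KbProjective 𝒜) :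
    Function.Bijective (((boundedProjectiveComplex 𝒜).ι ⋙ DerivedCategory.Qh).map :
      (K ⟶ L) → _) := by
  obtain ⟨K, hK⟩ := K
  obtain ⟨K', hK', rfl⟩ := boundedProjectiveComplex.exists_quotient_obj_eq hK
  have := hK'.isKProjective
  exact (CochainComplex.IsKProjective.Qh_map_bijective K' L.obj).comp
    (boundedProjectiveComplex 𝒜).fullyFaithfulι.homEquiv.bijective

instance : ((boundedProjectiveComplex 𝒜).ι ⋙ DerivedCategory.Qh).Full where
  map_surjective := (KbProjective.map_Qh_bijective 𝒜 _ _).surjective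

instance : ((boundedProjectiveComplex 𝒜).ι ⋙ DerivedCategory.Qh).Faithful where
  map_injective h := (KbProjective.map_Qh_bijective 𝒜 _ _).injective h

instance : (KbProjective.toBounded 𝒜).Full := by
  unfold KbProjective.toBounded
  infer_instance

instance : (KbProjective.toBounded 𝒜).Faithful := by
  unfold KbProjective.toBounded
  infer_instance

variable {𝒜}

lemma KbProjective.essImage_toBounded_iff (X : DerivedCategory.Bounded 𝒜) :
    (KbProjective.toBounded 𝒜).essImage X ↔ DerivedCategory.boundedProjective 𝒜 X.obj := by
  constructor
  · rintro ⟨⟨K, hK⟩, ⟨e⟩⟩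
    obtain ⟨L, hL, rfl⟩ := boundedProjectiveComplex.exists_quotient_obj_eq hK
    exact ⟨L, hL, ⟨(DerivedCategory.Bounded.ι.mapIso e).symm ≪≫
      (DerivedCategory.quotientCompQhIso 𝒜).app L⟩⟩
  · rintro ⟨L, hL, ⟨e⟩⟩
    exact ⟨⟨(HomotopyCategory.quotient _ _).obj L, hL⟩, ⟨ObjectProperty.isoMk _
      ((DerivedCategory.quotientCompQhIso 𝒜).app L ≪≫ e.symm)⟩⟩

/-! ### Perfect objects and uniform vanishing -/

namespace DerivedCategory.Bounded

open DerivedCategory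

lemma exists_shift_hom_ne_zero_iff (X Y : DerivedCategory.Bounded 𝒜) (i : ℤ) :
    (∃ f : X ⟶ Y⟦i⟧, f ≠ 0) ↔ ∃ f : X.obj ⟶ Y.obj⟦i⟧, f ≠ 0 := by
  let e : (Y⟦i⟧).obj ≅ Y.obj⟦i⟧ := (Bounded.ι.commShiftIso i).app Y
  constructor
  · rintro ⟨f, hf⟩
    refine ⟨f.hom ≫ e.hom, fun h => hf ?_⟩
    rw [← zero_comp (f := e.hom), cancel_mono] at h
    exact ObjectProperty.hom_ext _ h
  · rintro ⟨f, hf⟩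
    refine ⟨ObjectProperty.homMk (f ≫ e.inv), fun h => hf ?_⟩
    rw [← cancel_mono e.inv, zero_comp]
    exact congr_arg (fun g => g.hom) h

/-- The object of the bounded derived category given by an object of the abelian category. -/
noncomputable def single (A : 𝒜) : DerivedCategory.Bounded 𝒜 :=
  ⟨(singleFunctor 𝒜 0).obj A, ⟨0, inferInstance⟩, ⟨0, inferInstance⟩⟩

lemma exists_singleFunctor_eq_zero {P : DerivedCategory.Bounded 𝒜}
    (hP : IsPerfectObject _ P) (A : 𝒜) :
    ∃ m : ℤ, ∀ (n : ℤ) (_ : n < m) (f : P.obj ⟶ (singleFunctor 𝒜 n).obj A), f = 0 := by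
  obtain ⟨M, hM⟩ := (hP (single A)).bddAbove
  refine ⟨-M, fun n hn f => by_contra fun hf => ?_⟩
  let e : ((singleFunctor 𝒜 0).obj A)⟦-n⟧ ≅ (singleFunctor 𝒜 n).obj A :=
    ((singleFunctors 𝒜).shiftIso (-n) n 0 (by lia)).app A
  have : -n ≤ M := hM ((exists_shift_hom_ne_zero_iff _ _ _).2 ⟨f ≫ e.inv, fun h => hf (by
    rw [← cancel_mono e.inv, zero_comp]
    exact h)⟩)
  lia

/-- For small `i` the t-structure gives vanishing; for large `i`, `Y⟦i⟧` lies below all terms of the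
complex. -/
lemma isPerfectObject_of_boundedProjective {P : DerivedCategory.Bounded 𝒜}
    (hP : boundedProjective 𝒜 P.obj) : IsPerfectObject _ P := by
  intro Y
  obtain ⟨-, b, hb⟩ := P.property
  obtain ⟨⟨c, hc⟩, d, hd⟩ := Y.property
  obtain ⟨a, ha⟩ := exists_eq_zero_of_boundedProjective hP
  refine (Set.finite_Icc (c - b) (d - a)).subset fun i hi => ?_
  obtain ⟨f, hf⟩ := (exists_shift_hom_ne_zero_iff _ _ _).1 hi
  by_contra h
  apply hf
  obtain h | h : i < c - b ∨ d - a < i := by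
    rw [Set.mem_Icc] at h
    lia
  · have := TStructure.t.isGE_shift Y.obj c i (c - i)
    exact TStructure.t.zero_of_isLE_of_isGE f b (c - i) (by lia) hb this
  · have := TStructure.t.isLE_shift Y.obj d i (d - i)
    exact ha (Y.obj⟦i⟧) (d - i) (by lia) f

lemma boundedProjective_of_uniform_vanishing [EnoughProjectives 𝒜]
    (P : DerivedCategory.Bounded 𝒜) (m : ℤ)
    (h : ∀ (A : 𝒜) (n : ℤ) (_ : n < m) (f : P.obj ⟶ (singleFunctor 𝒜 n).obj A), f = 0) :
    boundedProjective 𝒜 P.obj := by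
  obtain ⟨P, ⟨c, hc⟩, b, hb⟩ := P
  -- `min m c` serves both as lower bound for `P` and as vanishing threshold. If `b` is smaller,
  -- `toNat` gives 0, which only weakens the upper bound.
  have : P.IsGE (min m c) := TStructure.t.isGE_of_ge P _ c
  have : P.IsLE (min m c + ((b - min m c).toNat : ℕ)) := TStructure.t.isLE_of_le P b _
  exact boundedProjective_of_singleFunctor_eq_zero (min m c) (b - min m c).toNat P
    fun A n hn f => h A n (by lia) f

lemma exists_uniform_vanishing_of_isFinitelyFiltrated (h𝒜 : IsFinitelyFiltrated 𝒜)
    {P : DerivedCategory.Bounded 𝒜} (hP : IsPerfectObject _ P) :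
    ∃ m : ℤ, ∀ (A : 𝒜) (n : ℤ) (_ : n < m) (f : P.obj ⟶ (singleFunctor 𝒜 n).obj A), f = 0 := by
  obtain ⟨r, S, hS⟩ := h𝒜
  choose m hm using fun j => exists_singleFunctor_eq_zero hP (S j)
  obtain ⟨m₀, hm₀⟩ := (Set.finite_range m).bddBelow
  have hzero {A B : 𝒜} (e : A ≅ B) {n : ℤ}
      (h : ∀ f : P.obj ⟶ (singleFunctor 𝒜 n).obj B, f = 0)
      (f : P.obj ⟶ (singleFunctor 𝒜 n).obj A) : f = 0 := by
    rw [← cancel_mono ((singleFunctor 𝒜 n).map e.hom), h (f ≫ _), zero_comp]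
  refine ⟨m₀, fun A n hn => ?_⟩
  by_cases hA : IsZero A
  · exact fun f => ((singleFunctor 𝒜 n).map_isZero hA).eq_of_tgt _ _
  obtain ⟨l, F, φ, h₀, ⟨e⟩, hφ⟩ := hS A hA
  refine hzero e.symm ?_
  generalize Fin.last l = i
  induction i using Fin.induction with
  | zero => exact fun f => ((singleFunctor 𝒜 n).map_isZero h₀).eq_of_tgt _ _
  | succ i ih =>
    obtain ⟨_, j, ⟨e'⟩⟩ := hφ i
    have hS : (ShortComplex.mk (φ i) (cokernel.π (φ i)) (cokernel.condition _)).ShortExact :=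
      { exact := ShortComplex.exact_cokernel _ }
    exact singleFunctor_eq_zero_of_shortExact hS ih
      (hzero e' (hm j n (by linarith [hm₀ (Set.mem_range_self j)])))

/-- Otherwise nonzero maps to `A k` in degrees below `-k` stay nonzero in the coproduct, whose
inclusions are split monomorphisms, contradicting the bound for `∐ A`. -/
lemma exists_uniform_vanishing_of_hasCountableCoproducts [HasCountableCoproducts 𝒜]
    {P : DerivedCategory.Bounded 𝒜} (hP : IsPerfectObject _ P) :
    ∃ m : ℤ, ∀ (A : 𝒜) (n : ℤ) (_ : n < m) (f : P.obj ⟶ (singleFunctor 𝒜 n).obj A), f = 0 := by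
  by_contra! h
  choose A n hn f hf using fun k : ℕ => h (-k)
  obtain ⟨m, hm⟩ := exists_singleFunctor_eq_zero hP (∐ A)
  let k := (-m).toNat
  apply hf k
  rw [← cancel_mono ((singleFunctor 𝒜 (n k)).map (Sigma.ι A k)), zero_comp]
  exact hm (n k) (by have := hn k; lia) _

end DerivedCategory.Bounded

theorem proposition2p2 (𝒜 : Type u) [Category.{v} 𝒜] [Abelian 𝒜] [EnoughProjectives 𝒜]
    [HasDerivedCategory.{w} 𝒜] :
    ((KbProjective.toBounded 𝒜).Full ∧ (KbProjective.toBounded 𝒜).Faithful) ∧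
    (IsFinitelyFiltrated 𝒜 →
      IsPerfectObject (DerivedCategory.Bounded 𝒜) = (KbProjective.toBounded 𝒜).essImage) ∧
    (HasCountableCoproducts 𝒜 →
      IsPerfectObject (DerivedCategory.Bounded 𝒜) = (KbProjective.toBounded 𝒜).essImage) := by
  refine ⟨⟨inferInstance, inferInstance⟩, fun h => ?_, fun _ => ?_⟩
  all_goals
    ext P
    rw [KbProjective.essImage_toBounded_iff]
    refine ⟨fun hP => ?_, DerivedCategory.Bounded.isPerfectObject_of_boundedProjective⟩
  · obtain ⟨m, hm⟩ :=
      DerivedCategory.Bounded.exists_uniform_vanishing_of_isFinitelyFiltrated h hP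
    exact DerivedCategory.Bounded.boundedProjective_of_uniform_vanishing P m hm
  · obtain ⟨m, hm⟩ :=
      DerivedCategory.Bounded.exists_uniform_vanishing_of_hasCountableCoproducts hP
    exact DerivedCategory.Bounded.boundedProjective_of_uniform_vanishing P m hm
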